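/- **Theorem.** Let $d\in\{2,3\}$, let $\Omega\subset\mathbb R^d$ be a polygonal (polyhedral) domain with Lipschitz boundary, and let $\mathcal T_h$ be a conforming triangulation of $\Omega$ into simplices $K$ with diameters $h_K$; let $\mathcal E_h$ be the set of the faces $E$ (of dimension $d-1$) of the simplices of $\mathcal T_h$. Let $k\ge 0$ be an integer, and let $$\boldsymbol V_h=\{\boldsymbol v\in[L^2(\Omega)]^d:\boldsymbol v|_K\in[\mathcal P^k(K)]^d\ \forall K\in\mathcal T_h\},\quad W_h=\{w\in L^2(\Omega):w|_K\in\mathcal P^{k+1}(K)\ \forall K\in\mathcal T_h\},$$ $$M_h=\{\mu\in L^2(\mathcal E_h):\mu|_E\in\mathcal P^k(E)\ \forall E\in\mathcal E_h\},$$ where $\mathcal P^k$ denotes polynomials of total degree at most $k$. Write $(w,v)_{\mathcal T_h}=\sum_{K}\int_K wv$ (with the dot product for vector fields), $\langle\zeta,\rho\rangle_{\partial\mathcal T_h}=\sum_K\int_{\partial K}\zeta\rho$, let $\boldsymbol n$ be the outward unit normal on $\partial K$, let $\Pi_k^\partial$ be the $L^2(E)$-orthogonal projection onto $\mathcal P^k(E)$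 on each face $E$ of each $K$, and set $$\mathcal A(\boldsymbol q,u,\widehat u;\boldsymbol r,w,\mu)=(\boldsymbol q,\boldsymbol r)_{\mathcal T_h}-(u,\nabla\cdot\boldsymbol r)_{\mathcal T_h}+\langle\widehat u,\boldsymbol r\cdot\boldsymbol n\rangle_{\partial\mathcal T_h}+(\nabla\cdot\boldsymbol q,w)_{\mathcal T_h}-\langle\boldsymbol q\cdot\boldsymbol n,\mu\rangle_{\partial\mathcal T_h}+\langle h_K^{-1}(\Pi_k^\partial u-\widehat u),\Pi_k^\partial w-\mu\rangle_{\partial\mathcal T_h}.$$ Let $\epsilon>0$, $T>0$, let $N\ge1$ be an integer, $\Delta t=T/N$, and $u^0\in L^2(\Omega)$. Let $f^n(u_h^n)=(u_h^n)^3-u_h^n$ (fully implicit scheme) or $f^n(u_h^n)=(u_h^n)^3-u_h^{n-1}$ (convex-splitting scheme). Given $u_h^{n-1}\in W_h$, one time step of the hybridizable discontinuous Galerkin (HDG) scheme for the Cahn-Hilliard equation asks for $(\boldsymbol p_h^n,\phi_h^n,\widehat\phi_h^n),(\boldsymbol q_h^n,u_h^n,\widehat u_h^n)\in\boldsymbol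 V_h\times W_h\times M_h$ such that $$\Big(\tfrac{u_h^n-u_h^{n-1}}{\Delta t},w_1\Big)_{\mathcal T_h}+\mathcal A(\boldsymbol p_h^n,\phi_h^n,\widehat\phi_h^n;\boldsymbol r_1,w_1,\mu_1)=0,$$ $$(\epsilon^{-1}f^n(u_h^n),w_2)_{\mathcal T_h}+\epsilon\,\mathcal A(\boldsymbol q_h^n,u_h^n,\widehat u_h^n;\boldsymbol r_2,w_2,\mu_2)-(\phi_h^n,w_2)_{\mathcal T_h}=0$$ for all $(\boldsymbol r_1,w_1,\mu_1),(\boldsymbol r_2,w_2,\mu_2)\in\boldsymbol V_h\times W_h\times M_h$. Then, for each of the two choices of $f^n$, the fully discrete scheme has at least one solution: there are $u_h^0\in W_h$ with $(u_h^0,w_3)_{\mathcal T_h}=(u^0,w_3)_{\mathcal T_h}$ for all $w_3\in W_h$, and $(\boldsymbol p_h^n,\phi_h^n,\widehat\phi_h^n),(\boldsymbol q_h^n,u_h^n,\widehat u_h^n)\in\boldsymbol V_h\times W_h\times M_h$, $n=1,\dots,N$, that satisfy the two equations above for every $n=1,\dots,N$. Moreover, each time step is solvable: for every $u_h^{n-1}\in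 W_h$ the two equations have at least one solution. -/

import Mathlib

open MeasureTheory

namespace HDG

noncomputable section

/-- `ℝᵈ` with its Euclidean structure. -/
abbrev Pt (d : ℕ) := EuclideanSpace ℝ (Fin d)

/-! ### Domain and mesh -/

/-- `Ω` has a Lipschitz boundary: near each boundary point there are a unit vector `ν` and a
Lipschitz function `g` of the coordinates orthogonal to `ν` such that `Ω` is locally the set of
points lying above the graph of `g` in the direction `ν`. -/
def HasLipschitzBoundary {d : ℕ} (Ω : Set (Pt d)) : Prop :=
  ∀ x ∈ frontier Ω, ∃ (ν : Pt d) (r : ℝ) (L : NNReal) (g : Pt d → ℝ),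
    ‖ν‖ = 1 ∧ 0 < r ∧ LipschitzWith L g ∧ (∀ (y : Pt d) (t : ℝ), g (y + t • ν) = g y) ∧
    ∀ y ∈ Metric.ball x r, (y ∈ Ω ↔ g y < inner ℝ ν y)

/-- A conforming triangulation of `Ω`: a finite simplicial complex, all of whose faces are faces
of `d`-simplices, that covers the closure of `Ω`. Simplices are recorded by their vertices. -/
structure Triangulation {d : ℕ} (Ω : Set (Pt d)) where
  complex : Geometry.SimplicialComplex ℝ (Pt d)
  finite : complex.faces.Finite
  pure : ∀ s ∈ complex.faces, ∃ K ∈ complex.faces, s ⊆ K ∧ K.card = d + 1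
  space_eq : complex.space = closure Ω

/-- The closed simplex with vertex set `s`. -/
def body {d : ℕ} (s : Finset (Pt d)) : Set (Pt d) := convexHull ℝ (s : Set (Pt d))

/-- The barycentre of the simplex with vertex set `s`. -/
def barycentre {d : ℕ} (s : Finset (Pt d)) : Pt d := (s.card : ℝ)⁻¹ • ∑ x ∈ s, x

/-- The vector joining the barycentre of `K` to that of its facet `F`, made orthogonal to `F`. -/
def normalVec {d : ℕ} (K F : Finset (Pt d)) : Pt d :=
  (vectorSpan ℝ (F : Set (Pt d)))ᗮ.starProjection (barycentre F - barycentre K)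

/-- The outward unit normal of the simplex `K` on its facet `F`. -/
def normal {d : ℕ} (K F : Finset (Pt d)) : Pt d := ‖normalVec K F‖⁻¹ • normalVec K F

/-- The diameter `h_K`. -/
def hK {d : ℕ} (K : Finset (Pt d)) : ℝ := Metric.diam (body K)

namespace Triangulation

variable {d : ℕ} {Ω : Set (Pt d)}

/-- The elements `K` of the mesh. -/
def cells (𝒯 : Triangulation Ω) : Finset (Finset (Pt d)) :=
  𝒯.finite.toFinset.filter (fun s => s.card = d + 1)

/-- The faces `E` (of codimension one) of the elements of the mesh. -/
def facets (𝒯 : Triangulation Ω) : Finset (Finset (Pt d)) :=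
  𝒯.finite.toFinset.filter (fun s => s.card = d)

end Triangulation

/-! ### Polynomials and the discrete spaces -/

/-- Evaluation of a polynomial in `d` variables as a function on `ℝᵈ`. -/
def evalFun (d : ℕ) : MvPolynomial (Fin d) ℝ →ₗ[ℝ] (Pt d → ℝ) where
  toFun p := fun x => MvPolynomial.eval (fun i => x i) p
  map_add' p q := by ext x; simp
  map_smul' c p := by ext x; simp [MvPolynomial.smul_eval]

/-- Polynomial functions on `ℝᵈ` of total degree at most `k`. A `d`-simplex has nonempty interior,
so these are also the polynomials on an element `K`, each given by its only extension to `ℝᵈ`. -/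
def polyFun (d k : ℕ) : Submodule ℝ (Pt d → ℝ) :=
  (MvPolynomial.restrictTotalDegree (Fin d) ℝ k).map (evalFun d)

/-- Vector fields whose components are polynomials of degree at most `k`. -/
def vecPolyFun (d k : ℕ) : Submodule ℝ (Pt d → Pt d) where
  carrier := {v | ∀ i, (fun x => v x i) ∈ polyFun d k}
  add_mem' ha hb i := (polyFun d k).add_mem (ha i) (hb i)
  zero_mem' _ := (polyFun d k).zero_mem
  smul_mem' c _ ha i := (polyFun d k).smul_mem c (ha i)

/-- Restriction of functions to a set, the result being extended by zero. -/
def restrictFun {d : ℕ} (S : Set (Pt d)) : (Pt d → ℝ) →ₗ[ℝ] (Pt d → ℝ) where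
  toFun f := S.indicator f
  map_add' f g := Set.indicator_add S f g
  map_smul' c f := Set.indicator_const_smul S c f

/-- Functions on the face `F` that are restrictions of polynomials of degree at most `k`
(extended by zero off `F`). -/
def facePoly {d : ℕ} (k : ℕ) (F : Finset (Pt d)) : Submodule ℝ (Pt d → ℝ) :=
  (polyFun d k).map (restrictFun (body F))

section Spaces

variable {d : ℕ} {Ω : Set (Pt d)}

/-- Discontinuous piecewise polynomial vector fields of degree `k`. -/
abbrev Vh (𝒯 : Triangulation Ω) (k : ℕ) : Submodule ℝ (𝒯.cells → Pt d → Pt d) :=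
  Submodule.pi Set.univ (fun _ => vecPolyFun d k)

/-- Discontinuous piecewise polynomials of degree `k + 1`. -/
abbrev Wh (𝒯 : Triangulation Ω) (k : ℕ) : Submodule ℝ (𝒯.cells → Pt d → ℝ) :=
  Submodule.pi Set.univ (fun _ => polyFun d (k + 1))

/-- Piecewise polynomials of degree `k` on the mesh skeleton (single valued on every face). -/
abbrev Mh (𝒯 : Triangulation Ω) (k : ℕ) : Submodule ℝ (𝒯.facets → Pt d → ℝ) :=
  Submodule.pi Set.univ (fun F => facePoly k F.1)

/-- `∑_K ∫_K g_K`. -/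
def cellSum (𝒯 : Triangulation Ω) (g : 𝒯.cells → Pt d → ℝ) : ℝ :=
  ∑ K : 𝒯.cells, ∫ x in body K.1, g K x

open scoped Classical in
/-- `∑_K ∫_{∂K} g_K`: the boundary of `K` is the union of its facets, and the integral over a
facet is taken with respect to the `(d - 1)`-dimensional surface measure. -/
def bdrySum (𝒯 : Triangulation Ω) (g : 𝒯.cells → 𝒯.facets → Pt d → ℝ) : ℝ :=
  ∑ K : 𝒯.cells, ∑ F : 𝒯.facets with F.1 ⊆ K.1, ∫ x in body F.1, g K F x ∂μHE[d - 1]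

/-- The divergence of a vector field. -/
def divg (v : Pt d → Pt d) (x : Pt d) : ℝ :=
  ∑ i : Fin d, (fderiv ℝ v x (EuclideanSpace.single i 1)) i

/-- `m` is the `L²(F)` projection of `g` onto the polynomials of degree at most `k` on `F`. -/
def IsFaceProj (k : ℕ) (F : Finset (Pt d)) (g m : Pt d → ℝ) : Prop :=
  m ∈ facePoly k F ∧ ∀ μ ∈ facePoly k F,
    ∫ x in body F, m x * μ x ∂μHE[d - 1] = ∫ x in body F, g x * μ x ∂μHE[d - 1]

open scoped Classical in
/-- The `L²` projection `Π_k^∂` on the face `F`. -/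
def faceProj (k : ℕ) (F : Finset (Pt d)) (g : Pt d → ℝ) : Pt d → ℝ :=
  if h : ∃ m, IsFaceProj k F g m then h.choose else 0

/-! ### The scheme -/

/-- The HDG form `𝒜(q, u, û; r, w, μ)`. -/
def formA (𝒯 : Triangulation Ω) (k : ℕ)
    (q : Vh 𝒯 k) (u : Wh 𝒯 k) (uhat : Mh 𝒯 k)
    (r : Vh 𝒯 k) (w : Wh 𝒯 k) (μ : Mh 𝒯 k) : ℝ :=
  cellSum 𝒯 (fun K x => inner ℝ (q.1 K x) (r.1 K x))
  - cellSum 𝒯 (fun K x => u.1 K x * divg (r.1 K) x)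
  + bdrySum 𝒯 (fun K F x => uhat.1 F x * inner ℝ (r.1 K x) (normal K.1 F.1))
  + cellSum 𝒯 (fun K x => divg (q.1 K) x * w.1 K x)
  - bdrySum 𝒯 (fun K F x => inner ℝ (q.1 K x) (normal K.1 F.1) * μ.1 F x)
  + bdrySum 𝒯 (fun K F x => (hK K.1)⁻¹ * (faceProj k F.1 (u.1 K) x - uhat.1 F x)
      * (faceProj k F.1 (w.1 K) x - μ.1 F x))

/-- The two time discretizations. -/
inductive TimeScheme
  | fullyImplicit
  | convexSplitting

/-- The value `f^n(u^n)`, as a function of `u = u^n` and `v = u^{n-1}`. -/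
def TimeScheme.f : TimeScheme → ℝ → ℝ → ℝ
  | fullyImplicit, u, _ => u ^ 3 - u
  | convexSplitting, u, v => u ^ 3 - v

/-- One time step of length `Δt`: given `uprev = u_h^{n-1}`, the unknowns satisfy the two
variational equations of the scheme. -/
def IsStep (𝒯 : Triangulation Ω) (k : ℕ) (s : TimeScheme) (ε Δt : ℝ) (uprev : Wh 𝒯 k)
    (p : Vh 𝒯 k) (φ : Wh 𝒯 k) (φhat : Mh 𝒯 k)
    (q : Vh 𝒯 k) (u : Wh 𝒯 k) (uhat : Mh 𝒯 k) : Prop :=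
  (∀ (r : Vh 𝒯 k) (w : Wh 𝒯 k) (μ : Mh 𝒯 k),
    cellSum 𝒯 (fun K x => (u.1 K x - uprev.1 K x) / Δt * w.1 K x)
      + formA 𝒯 k p φ φhat r w μ = 0) ∧
  (∀ (r : Vh 𝒯 k) (w : Wh 𝒯 k) (μ : Mh 𝒯 k),
    cellSum 𝒯 (fun K x => ε⁻¹ * s.f (u.1 K x) (uprev.1 K x) * w.1 K x)
      + ε * formA 𝒯 k q u uhat r w μ
      - cellSum 𝒯 (fun K x => φ.1 K x * w.1 K x) = 0)

/-- `(p^n, φ^n, φ̂^n, q^n, u^n, û^n)`, `1 ≤ n ≤ N`, together with `u^0`, solve the fully discrete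
scheme with initial datum `u₀`. -/
def IsSolution (𝒯 : Triangulation Ω) (k : ℕ) (s : TimeScheme) (ε Δt : ℝ) (N : ℕ) (u₀ : Pt d → ℝ)
    (p : ℕ → Vh 𝒯 k) (φ : ℕ → Wh 𝒯 k) (φhat : ℕ → Mh 𝒯 k)
    (q : ℕ → Vh 𝒯 k) (u : ℕ → Wh 𝒯 k) (uhat : ℕ → Mh 𝒯 k) : Prop :=
  (∀ w : Wh 𝒯 k, cellSum 𝒯 (fun K x => (u 0).1 K x * w.1 K x)
      - cellSum 𝒯 (fun K x => u₀ x * w.1 K x) = 0) ∧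
  ∀ n, 1 ≤ n → n ≤ N →
    IsStep 𝒯 k s ε Δt (u (n - 1)) (p n) (φ n) (φhat n) (q n) (u n) (uhat n)

end Spaces

end

end HDG

/-!
Each time step is the Euler-Lagrange equation of a coercive functional on a finite-dimensional
space, so it has a solution because that functional has a minimizer.

The form `𝒜` is a mixed form built from a mass form, a divergence pairing, a trace pairing and a
stabilization (`HDG.formA_eq_mixedForm`). For a given element unknown, the equations tested with
`(r, 0, μ)` determine the flux and the skeleton unknown; eliminating them leaves a symmetric
positive semidefinite form `a` on `W_h` (`HDG.exists_static_condensation`). In terms of `a` the step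
reads `(u - v, w) / Δt + a(φ, w) = 0` and `(φ, w) = G'(u) w`, where
`G(u) = ε⁻¹ ∫ F(u, v) + (ε / 2) a(u, u)` and `F` is a primitive of `f`. The quartic term makes `G`
bounded below (`HDG.exists_le_potential`). Factoring `a(x, y) = ⟪S x, S y⟫` through a Euclidean space
and letting `D` be the adjoint of `S` for the mass form, a minimizer `η` of
`(Δt / 2) ‖η‖² + G (v - Δt • D η)` satisfies `η = S φ` with `φ` the gradient of `G` at
`u = v - Δt • D η`, which is the step (`HDG.exists_implicit_gradient_step`). The kernel of `a` is
harmless in this formulation.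

Element mass forms are definite, since a polynomial that vanishes on an open set is zero. On facets
it is enough that the surface measure is finite: skeleton functions that vanish almost everywhere
enter none of the forms, and the facet projection agrees almost everywhere with a linear map.
The initial projection needs the datum to be square integrable on the closed elements, hence that a
Lipschitz boundary is a null set (`HDG.volume_frontier_eq_zero`).
-/

namespace HDG

/-! ### Finite-dimensional linear algebra -/

/-- A positive semidefinite bilinear form `C`, not assumed symmetric, represents every functional
that vanishes on its kernel, and the representing vector can be chosen linearly. -/
theorem exists_linearMap_represent_of_semidefinite {Y W : Type*} [AddCommGroup Y] [Module ℝ Y]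
    [FiniteDimensional ℝ Y] [AddCommGroup W] [Module ℝ W]
    (C : Y →ₗ[ℝ] Y →ₗ[ℝ] ℝ) (l : W →ₗ[ℝ] Y →ₗ[ℝ] ℝ)
    (hC : ∀ y, 0 ≤ C y y) (hl : ∀ w y, C y = 0 → l w y = 0) :
    ∃ P : W →ₗ[ℝ] Y, ∀ w, C (P w) = l w := by
  -- Expanding `0 ≤ C (x + t • y) (x + t • y)` shows that the left kernel is a right kernel.
  have hker : ∀ x y, C y = 0 → C x y = 0 := by
    intro x y hy
    have h : ∀ t : ℝ, 0 ≤ C x x + t * C x y := fun t => by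
      have := hC (x + t • y)
      simpa [hy] using this
    by_contra hne
    have := h (-(C x x + 1) / C x y)
    rw [div_mul_cancel₀ _ hne] at this
    linarith
  have hle : LinearMap.range C ≤ (LinearMap.ker C).dualAnnihilator := by
    rintro _ ⟨x, rfl⟩
    rw [Submodule.mem_dualAnnihilator]
    exact fun y hy => hker x y hy
  -- The range lies in the annihilator of the kernel and has the same dimension.
  have hfin : Module.finrank ℝ (LinearMap.range C)
      = Module.finrank ℝ (LinearMap.ker C).dualAnnihilator := by
    have h1 := C.finrank_range_add_finrank_ker
    have h2 := Subspace.finrank_add_finrank_dualAnnihilator_eq (LinearMap.ker C)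
    omega
  have heq := Submodule.eq_of_le_of_finrank_eq hle hfin
  have hmem : ∀ w, l w ∈ LinearMap.range C := fun w => by
    rw [heq, Submodule.mem_dualAnnihilator]
    exact fun y hy => hl w y hy
  obtain ⟨P, hP⟩ := Module.projective_lifting_property C.rangeRestrict
    (l.codRestrict (LinearMap.range C) hmem) C.surjective_rangeRestrict
  exact ⟨P, fun w => congrArg Subtype.val (LinearMap.congr_fun hP w)⟩

/-- A symmetric positive semidefinite form on a finite-dimensional space is the pullback of a
Euclidean inner product. -/
theorem exists_linearMap_inner_eq {W : Type*} [AddCommGroup W] [Module ℝ W]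
    [FiniteDimensional ℝ W] (a : W →ₗ[ℝ] W →ₗ[ℝ] ℝ) (hsymm : ∀ x y, a x y = a y x)
    (hpos : ∀ x, 0 ≤ a x x) :
    ∃ (n : ℕ) (S : W →ₗ[ℝ] EuclideanSpace ℝ (Fin n)), ∀ x y, a x y = inner ℝ (S x) (S y) := by
  let b := Module.finBasis ℝ W
  have hexp : ∀ x y, a x y = ∑ i, ∑ j, b.repr x i * (b.repr y j * a (b i) (b j)) := by
    intro x y
    conv_lhs => rw [← b.sum_repr x, ← b.sum_repr y]
    simp only [map_sum, map_smul, LinearMap.sum_apply, LinearMap.smul_apply, smul_eq_mul,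
      Finset.mul_sum]
    rw [Finset.sum_comm]
    exact Finset.sum_congr rfl fun i _ => Finset.sum_congr rfl fun j _ => by ring
  have hpd : (Matrix.of fun i j => a (b i) (b j)).PosSemidef := by
    refine Matrix.PosSemidef.of_dotProduct_mulVec_nonneg ?_ fun x => ?_
    · ext i j
      simp [hsymm]
    · have := hpos (b.equivFun.symm x)
      rw [hexp] at this
      simp only [← Module.Basis.equivFun_apply, LinearEquiv.apply_symm_apply] at this
      simpa [dotProduct, Matrix.mulVec, Finset.mul_sum, mul_comm] using this
  obtain ⟨m, v, hv⟩ := Matrix.posSemidef_iff_eq_sum_vecMulVec.1 hpd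
  have hab : ∀ i j, a (b i) (b j) = ∑ k, v k i * v k j := fun i j => by
    have := congrFun (congrFun hv i) j
    simpa [Matrix.sum_apply, Matrix.vecMulVec_apply] using this
  let S : W →ₗ[ℝ] EuclideanSpace ℝ (Fin m) :=
    (WithLp.linearEquiv 2 ℝ (Fin m → ℝ)).symm.toLinearMap ∘ₗ
      LinearMap.pi fun k => ∑ i, v k i • b.coord i
  have hSk : ∀ x k, S x k = ∑ i, v k i * b.repr x i := fun x k => by
    change (LinearMap.pi fun k => ∑ i, v k i • b.coord i : W →ₗ[ℝ] Fin m → ℝ) x k = _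
    simp
  refine ⟨m, S, fun x y => ?_⟩
  rw [hexp]
  simp only [hab, PiLp.inner_apply, hSk, RCLike.inner_apply, conj_trivial]
  simp only [Finset.mul_sum, Finset.sum_mul]
  rw [Finset.sum_congr rfl fun i _ => Finset.sum_comm, Finset.sum_comm]
  refine Finset.sum_congr rfl fun k _ => ?_
  refine Finset.sum_congr rfl fun j _ => Finset.sum_congr rfl fun i _ => ?_
  ring

/-! ### Implicit gradient steps by minimization -/

/-- The functional `η ↦ τ / 2 * ‖η‖ ^ 2 + G (v - τ • D η)` is coercive because `G` is bounded
below, and a minimizer satisfies this Euler-Lagrange equation. -/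
theorem exists_inner_eq_deriv {E W : Type*} [NormedAddCommGroup E] [InnerProductSpace ℝ E]
    [FiniteDimensional ℝ E] [AddCommGroup W] [Module ℝ W] [TopologicalSpace W]
    [IsTopologicalAddGroup W] [ContinuousSMul ℝ W]
    (D : E →ₗ[ℝ] W) (G : W → ℝ) (g : W → W →ₗ[ℝ] ℝ) (hG : Continuous G) {c : ℝ}
    (hc : ∀ u, c ≤ G u) (hg : ∀ u w, HasDerivAt (fun t : ℝ => G (u + t • w)) (g u w) 0)
    (v : W) {τ : ℝ} (hτ : 0 < τ) :
    ∃ η : E, ∀ χ, inner ℝ η χ = g (v - τ • D η) (D χ) := by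
  let J : E → ℝ := fun η => τ / 2 * ‖η‖ ^ 2 + G (v - τ • D η)
  have hD : Continuous D := D.continuous_of_finiteDimensional
  have hJ : Continuous J := by fun_prop
  have hlim : Filter.Tendsto J (Filter.cocompact E) Filter.atTop := by
    refine Filter.tendsto_atTop_add_right_of_le _ c ?_ fun η => hc _
    refine Filter.Tendsto.const_mul_atTop (by positivity) ?_
    exact (Filter.tendsto_pow_atTop two_ne_zero).comp (tendsto_norm_cocompact_atTop)
  obtain ⟨η, hη⟩ := hJ.exists_forall_le hlim
  refine ⟨η, fun χ => ?_⟩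
  have h1 : HasDerivAt (fun t : ℝ => τ / 2 * ‖η + t • χ‖ ^ 2) (τ * inner ℝ η χ) 0 := by
    have : HasDerivAt (fun t : ℝ => η + t • χ) χ 0 := by
      simpa using ((hasDerivAt_id (0 : ℝ)).smul_const χ).const_add η
    have := this.norm_sq.const_mul (τ / 2)
    rw [zero_smul, add_zero, ← mul_assoc, div_mul_cancel₀ _ two_ne_zero] at this
    exact this
  have h2 : HasDerivAt (fun t : ℝ => G (v - τ • D (η + t • χ)))
      (g (v - τ • D η) (-(τ • D χ))) 0 := by
    refine (hg (v - τ • D η) (-(τ • D χ))).congr_of_eventuallyEq (.of_forall fun t => ?_)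
    refine congrArg G ?_
    rw [map_add, map_smul, smul_add, smul_neg, smul_comm t τ]
    abel
  have hmin : IsLocalMin (fun t : ℝ => J (η + t • χ)) 0 :=
    Filter.Eventually.of_forall fun t => by simpa using hη (η + t • χ)
  have h0 := hmin.hasDerivAt_eq_zero (h1.add h2)
  rw [map_neg, map_smul, smul_eq_mul, ← mul_neg, ← mul_add] at h0
  have := (mul_eq_zero.1 h0).resolve_left hτ.ne'
  linarith

theorem exists_linearMap_represent_of_definite {W X : Type*} [AddCommGroup W] [Module ℝ W]
    [FiniteDimensional ℝ W] [AddCommGroup X] [Module ℝ X] (m : W →ₗ[ℝ] W →ₗ[ℝ] ℝ)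
    (hm : ∀ w, 0 ≤ m w w) (hm0 : ∀ w, m w w = 0 → w = 0) (l : X →ₗ[ℝ] W →ₗ[ℝ] ℝ) :
    ∃ P : X →ₗ[ℝ] W, ∀ x w, m (P x) w = l x w := by
  obtain ⟨P, hP⟩ := exists_linearMap_represent_of_semidefinite m l hm fun x w hw => by
    rw [hm0 w (by rw [hw]; rfl), map_zero]
  exact ⟨P, fun x w => by rw [hP]⟩

/-- One implicit step `(u - v) / τ + A φ = 0`, `φ = G'(u)` of the gradient flow of `G` in the
metric dual to a positive semidefinite operator `A`, given by its form `a`. Writing `A` as a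
square in `exists_linearMap_inner_eq` turns the step into a minimization over a Euclidean space,
so that the kernel of `A` plays no role. -/
theorem exists_implicit_gradient_step {W : Type*} [AddCommGroup W] [Module ℝ W]
    [FiniteDimensional ℝ W] [TopologicalSpace W] [IsTopologicalAddGroup W] [ContinuousSMul ℝ W]
    (m a : W →ₗ[ℝ] W →ₗ[ℝ] ℝ) (hm : ∀ w, 0 ≤ m w w) (hm0 : ∀ w, m w w = 0 → w = 0)
    (hms : ∀ x y, m x y = m y x) (has : ∀ x y, a x y = a y x) (ha : ∀ w, 0 ≤ a w w)
    (G : W → ℝ) (g : W → W →ₗ[ℝ] ℝ) (hG : Continuous G) {c : ℝ}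
    (hc : ∀ u, c ≤ G u) (hg : ∀ u w, HasDerivAt (fun t : ℝ => G (u + t • w)) (g u w) 0)
    (v : W) {τ : ℝ} (hτ : 0 < τ) :
    ∃ u φ : W, (∀ w, m (u - v) w + τ * a φ w = 0) ∧ ∀ w, m φ w = g u w := by
  obtain ⟨n, S, hS⟩ := exists_linearMap_inner_eq a has ha
  obtain ⟨D, hD⟩ := exists_linearMap_represent_of_definite m hm hm0
    ((innerₗ (EuclideanSpace ℝ (Fin n))).compl₂ S)
  obtain ⟨η, hη⟩ := exists_inner_eq_deriv D G g hG hc hg v hτ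
  obtain ⟨P, hP⟩ := exists_linearMap_represent_of_definite m hm hm0
    (LinearMap.id : (W →ₗ[ℝ] ℝ) →ₗ[ℝ] (W →ₗ[ℝ] ℝ))
  set u := v - τ • D η with hu
  have hηS : η = S (P (g u)) := by
    refine ext_inner_right ℝ fun χ => ?_
    rw [hη, ← LinearMap.id_apply (R := ℝ) (g u), ← hP, LinearMap.id_apply, hms, hD]
    simp [real_inner_comm]
  refine ⟨u, P (g u), fun w => ?_, fun w => by rw [hP]; rfl⟩
  have : u - v = -(τ • D η) := by rw [hu]; abel
  rw [this, map_neg, map_smul, LinearMap.neg_apply, LinearMap.smul_apply, hD, hS, ← hηS]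
  simp

/-! ### Mixed hybrid forms -/

/-- The hybridized mixed form assembled from the mass form `m` of the fluxes, the divergence
pairing `b`, the trace pairing `c` and the stabilization `s`. -/
def mixedForm {V W M : Type*} [AddCommGroup V] [Module ℝ V] [AddCommGroup W] [Module ℝ W]
    [AddCommGroup M] [Module ℝ M] (m : V →ₗ[ℝ] V →ₗ[ℝ] ℝ) (b : V →ₗ[ℝ] W →ₗ[ℝ] ℝ)
    (c : V →ₗ[ℝ] M →ₗ[ℝ] ℝ) (s : (W × M) →ₗ[ℝ] (W × M) →ₗ[ℝ] ℝ)
    (q : V) (u : W) (u' : M) (r : V) (w : W) (μ : M) : ℝ :=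
  m q r - b r u + c r u' + b q w - c q μ + s (u, u') (w, μ)

/-- Static condensation: the flux and the skeleton unknown are determined by the element unknown,
and the reduced form is symmetric positive semidefinite. -/
theorem exists_static_condensation {V W M : Type*} [AddCommGroup V] [Module ℝ V]
    [FiniteDimensional ℝ V] [AddCommGroup W] [Module ℝ W]
    [AddCommGroup M] [Module ℝ M] [FiniteDimensional ℝ M]
    (m : V →ₗ[ℝ] V →ₗ[ℝ] ℝ) (b : V →ₗ[ℝ] W →ₗ[ℝ] ℝ) (c : V →ₗ[ℝ] M →ₗ[ℝ] ℝ)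
    (s : (W × M) →ₗ[ℝ] (W × M) →ₗ[ℝ] ℝ)
    (hm : ∀ q, 0 ≤ m q q) (hm0 : ∀ q, m q q = 0 → q = 0) (hms : ∀ q r, m q r = m r q)
    (hs : ∀ x, 0 ≤ s x x) (hss : ∀ x y, s x y = s y x)
    (hs0 : ∀ μ, s (0, μ) (0, μ) = 0 → s (0, μ) = 0 ∧ ∀ r, c r μ = 0) :
    ∃ (Q : W →ₗ[ℝ] V) (U : W →ₗ[ℝ] M) (a : W →ₗ[ℝ] W →ₗ[ℝ] ℝ),
      (∀ x y, a x y = a y x) ∧ (∀ w, 0 ≤ a w w) ∧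
      ∀ φ r w μ, mixedForm m b c s (Q φ) φ (U φ) r w μ = a φ w := by
  let C : (V × M) →ₗ[ℝ] (V × M) →ₗ[ℝ] ℝ :=
    m.compl₁₂ (LinearMap.fst ℝ V M) (LinearMap.fst ℝ V M)
    + (c.compl₁₂ (LinearMap.fst ℝ V M) (LinearMap.snd ℝ V M)).flip
    - c.compl₁₂ (LinearMap.fst ℝ V M) (LinearMap.snd ℝ V M)
    + s.compl₁₂ (LinearMap.inr ℝ W M ∘ₗ LinearMap.snd ℝ V M)
        (LinearMap.inr ℝ W M ∘ₗ LinearMap.snd ℝ V M)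
  have hCdef : ∀ p q μ ν, C (p, μ) (q, ν) = m p q + c q μ - c p ν + s (0, μ) (0, ν) := by
    intro p q μ ν
    simp [C]
  let l : W →ₗ[ℝ] (V × M) →ₗ[ℝ] ℝ :=
    b.flip.compl₂ (LinearMap.fst ℝ V M)
    - s.compl₁₂ (LinearMap.inl ℝ W M) (LinearMap.inr ℝ W M ∘ₗ LinearMap.snd ℝ V M)
  have hldef : ∀ w q ν, l w (q, ν) = b q w - s (w, 0) (0, ν) := by
    intro w q ν
    simp [l]
  obtain ⟨P, hP⟩ := exists_linearMap_represent_of_semidefinite C l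
    (by
      rintro ⟨q, μ⟩
      rw [hCdef]
      have := hm q
      have := hs (0, μ)
      linarith)
    (by
      rintro w ⟨q, μ⟩ h
      have h0 : C (q, μ) (q, μ) = 0 := by rw [h]; rfl
      rw [hCdef] at h0
      have h1 := hm q
      have h2 := hs (0, μ)
      have hq : q = 0 := hm0 q (by linarith)
      have hμ := hs0 μ (by linarith)
      rw [hldef, hss, hμ.1, hq]
      simp)
  have hP' : ∀ φ r μ, m (P φ).1 r + c r (P φ).2 - c (P φ).1 μ + s (0, (P φ).2) (0, μ)
      = b r φ - s (φ, 0) (0, μ) := fun φ r μ => by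
    rw [← hCdef, ← hldef, ← hP]
  have hsplit : ∀ (x : W) (y : M) z, s (x, y) z = s (x, 0) z + s (0, y) z := fun x y z => by
    rw [← LinearMap.add_apply, ← map_add]; simp
  have hsplit' : ∀ z (x : W) (y : M), s z (x, y) = s z (x, 0) + s z (0, y) := fun z x y => by
    rw [← map_add]; simp
  let L : W →ₗ[ℝ] W × M := LinearMap.prod LinearMap.id (LinearMap.snd ℝ V M ∘ₗ P)
  refine ⟨LinearMap.fst ℝ V M ∘ₗ P, LinearMap.snd ℝ V M ∘ₗ P,
    m.compl₁₂ (LinearMap.fst ℝ V M ∘ₗ P) (LinearMap.fst ℝ V M ∘ₗ P) + s.compl₁₂ L L,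
    fun x y => ?_, fun w => ?_, fun φ r w μ => ?_⟩
  · simp only [LinearMap.add_apply, LinearMap.compl₁₂_apply]
    rw [hms, hss]
  · exact add_nonneg (hm _) (hs _)
  · -- The equations for `φ` remove `r` and `μ`; those for `w`, tested with the flux of `φ`, turn
    -- the remaining pairings into the symmetric form.
    have e1 := hP' φ r μ
    have e2 := hP' φ 0 (P w).2
    have e3 := hP' w (P φ).1 0
    have e4 := hms (P w).1 (P φ).1
    have e5 := hP' φ 0 μ
    change m (P φ).1 r - b r φ + c r (P φ).2 + b (P φ).1 w - c (P φ).1 μ + s (φ, (P φ).2) (w, μ)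
      = m (P φ).1 (P w).1 + s (φ, (P φ).2) (w, (P w).2)
    rw [hsplit φ, hsplit φ (P φ).2 (w, (P w).2), hsplit' _ w μ, hsplit' _ w (P w).2, hsplit' (0, (P φ).2) w μ,
      hsplit' (0, (P φ).2) w (P w).2]
    have z : ((0 : W), (0 : M)) = 0 := rfl
    simp only [map_zero, z, LinearMap.zero_apply] at e2 e3 e5
    linarith

/-! ### Integration over compact sets -/

/-- Real functions on `ℝᵈ` that are continuous on `S`. -/
def contOn {d : ℕ} (S : Set (Pt d)) : Submodule ℝ (Pt d → ℝ) where
  carrier := {f | ContinuousOn f S}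
  add_mem' hf hg := hf.add hg
  zero_mem' := continuousOn_const
  smul_mem' c _ hf := hf.const_smul c

theorem integrableOn_of_continuousOn {d : ℕ} {ν : Measure (Pt d)} {S : Set (Pt d)}
    (hS : IsCompact S) (hν : ν S ≠ ⊤) {f : Pt d → ℝ} (hf : ContinuousOn f S) :
    IntegrableOn f S ν := by
  have : IsFiniteMeasure (ν.restrict S) := ⟨by
    rw [Measure.restrict_apply_univ]; exact hν.lt_top⟩
  have := hf.integrableOn_compact (μ := ν.restrict S) hS
  rwa [IntegrableOn, Measure.restrict_restrict hS.measurableSet, Set.inter_self] at this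

/-- The `L²(S, ν)` form on functions continuous on the compact set `S` of finite measure. -/
noncomputable def l2Form {d : ℕ} (ν : Measure (Pt d)) (S : Set (Pt d))
    (hS : IsCompact S) (hν : ν S ≠ ⊤) : contOn S →ₗ[ℝ] contOn S →ₗ[ℝ] ℝ :=
  LinearMap.mk₂ ℝ (fun f g => ∫ x in S, f.1 x * g.1 x ∂ν)
    (fun f f' g => by
      rw [← integral_add]
      · simp [add_mul]
      · exact integrableOn_of_continuousOn hS hν (f.2.mul g.2)
      · exact integrableOn_of_continuousOn hS hν (f'.2.mul g.2))
    (fun c f g => by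
      rw [smul_eq_mul, ← integral_const_mul]
      simp [mul_assoc])
    (fun f g g' => by
      rw [← integral_add]
      · simp [mul_add]
      · exact integrableOn_of_continuousOn hS hν (f.2.mul g.2)
      · exact integrableOn_of_continuousOn hS hν (f.2.mul g'.2))
    (fun c f g => by
      rw [smul_eq_mul, ← integral_const_mul]
      simp [mul_left_comm])

section l2Form

variable {d : ℕ} {ν : Measure (Pt d)} {S : Set (Pt d)} (hS : IsCompact S) (hν : ν S ≠ ⊤)

theorem l2Form_apply (f g : contOn S) : l2Form ν S hS hν f g = ∫ x in S, f.1 x * g.1 x ∂ν := rfl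

theorem l2Form_comm (f g : contOn S) : l2Form ν S hS hν f g = l2Form ν S hS hν g f := by
  simp only [l2Form_apply, mul_comm]

theorem l2Form_self_nonneg (f : contOn S) : 0 ≤ l2Form ν S hS hν f f :=
  integral_nonneg fun x => mul_self_nonneg (f.1 x)

theorem ae_eq_zero_of_l2Form_self (f : contOn S) (h : l2Form ν S hS hν f f = 0) :
    f.1 =ᵐ[ν.restrict S] 0 := by
  have h1 := (integral_eq_zero_iff_of_nonneg (fun x => mul_self_nonneg (f.1 x))
    (integrableOn_of_continuousOn hS hν (f.2.mul f.2))).1 h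
  filter_upwards [h1] with x hx using mul_self_eq_zero.1 hx

theorem l2Form_eq_zero_of_self (f : contOn S) (h : l2Form ν S hS hν f f = 0) :
    l2Form ν S hS hν f = 0 := by
  ext g
  rw [l2Form_apply, integral_congr_ae (g := 0)]
  · simp
  · filter_upwards [ae_eq_zero_of_l2Form_self hS hν f h] with x hx
    simp [hx]

end l2Form

/-! ### Polynomial functions -/

section Polynomial

variable {d k : ℕ}

instance finiteDimensional_polyFun : FiniteDimensional ℝ (polyFun d k) := by
  unfold polyFun
  infer_instance

theorem analyticOnNhd_of_mem_polyFun {f : Pt d → ℝ} (hf : f ∈ polyFun d k) :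
    AnalyticOnNhd ℝ f Set.univ := by
  obtain ⟨p, -, rfl⟩ := hf
  have := AnalyticOnNhd.aeval_mvPolynomial (𝕜 := ℝ) (A := ℝ) (s := Set.univ)
    (f := fun (x : Pt d) (i : Fin d) => x i)
    (fun i => fun x _ => (EuclideanSpace.proj (𝕜 := ℝ) i).analyticAt x) p
  exact this

theorem contDiff_of_mem_polyFun {f : Pt d → ℝ} (hf : f ∈ polyFun d k) : ContDiff ℝ 1 f :=
  (analyticOnNhd_of_mem_polyFun hf).contDiff

theorem continuous_of_mem_polyFun {f : Pt d → ℝ} (hf : f ∈ polyFun d k) : Continuous f :=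
  (contDiff_of_mem_polyFun hf).continuous

theorem contDiff_of_mem_vecPolyFun {v : Pt d → Pt d} (hv : v ∈ vecPolyFun d k) :
    ContDiff ℝ 1 v :=
  contDiff_euclidean.2 fun i => contDiff_of_mem_polyFun (hv i)

/-- A polynomial that vanishes almost everywhere on a set with interior vanishes identically, being
analytic. -/
theorem eq_zero_of_integral_mul_self_eq_zero {S : Set (Pt d)} (hS : IsCompact S)
    (hint : (interior S).Nonempty) {f : Pt d → ℝ} (hf : f ∈ polyFun d k)
    (h : ∫ x in S, f x * f x = 0) : f = 0 := by
  have hae := ae_eq_zero_of_l2Form_self hS hS.measure_lt_top.ne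
    ⟨f, (continuous_of_mem_polyFun hf).continuousOn⟩ h
  have hEq := Measure.eqOn_open_of_ae_eq
    (ae_restrict_of_ae_restrict_of_subset interior_subset hae) isOpen_interior
    (continuous_of_mem_polyFun hf).continuousOn continuousOn_const
  obtain ⟨x, hx⟩ := hint
  exact (analyticOnNhd_of_mem_polyFun hf).eq_of_eventuallyEq (z₀ := x)
    (fun y _ => analyticAt_const)
    (Filter.eventually_of_mem (isOpen_interior.mem_nhds hx) hEq)

end Polynomial

/-! ### Simplices -/

section Simplex

variable {d : ℕ}

theorem isCompact_body (s : Finset (Pt d)) : IsCompact (body s) :=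
  s.finite_toSet.isCompact_convexHull ℝ

theorem interior_body_nonempty {K : Finset (Pt d)} (hcard : K.card = d + 1)
    (hK : AffineIndependent ℝ ((↑) : K → Pt d)) : (interior (body K)).Nonempty := by
  rw [body, interior_convexHull_nonempty_iff_affineSpan_eq_top]
  have := hK.affineSpan_eq_top_iff_card_eq_finrank_add_one.2 (by simp [hcard])
  simpa using this

theorem hK_pos {K : Finset (Pt d)} (hd : 0 < d) (hcard : K.card = d + 1) : 0 < hK K := by
  obtain ⟨x, hx, y, hy, hxy⟩ := Finset.one_lt_card.1 (show 1 < K.card by omega)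
  exact (dist_pos.2 hxy).trans_le (Metric.dist_le_diam_of_mem (isCompact_body K).isBounded
    (subset_convexHull ℝ _ hx) (subset_convexHull ℝ _ hy))

/-- The facet lies in the isometric image of a ball of its `(d - 1)`-dimensional direction, where
the Hausdorff measure is a Haar measure. -/
theorem euclideanHausdorffMeasure_body_ne_top {F : Finset (Pt d)} (hd : 0 < d)
    (hcard : F.card = d) (hF : AffineIndependent ℝ ((↑) : F → Pt d)) :
    μHE[d - 1] (body F) ≠ ⊤ := by
  obtain ⟨x₀, hx₀⟩ := Finset.card_pos.1 (hcard ▸ hd)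
  let V := vectorSpan ℝ (F : Set (Pt d))
  have hrank : Module.finrank ℝ V = d - 1 := by
    have := hF.finrank_vectorSpan (n := d - 1) (by simp [hcard]; omega)
    exact (congrArg (fun U : Submodule ℝ (Pt d) => Module.finrank ℝ U)
      (show V = vectorSpan ℝ (Set.range ((↑) : F → Pt d)) by rw [Subtype.range_coe])).trans
      this
  have hiso : Isometry (fun v : V => (v : Pt d) + x₀) :=
    (isometry_add_right x₀).comp isometry_subtype_coe
  let R := Metric.diam (body F)
  have hsub : body F ⊆ (fun v : V => (v : Pt d) + x₀) '' Metric.closedBall 0 R := by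
    intro x hx
    have hx' : x ∈ affineSpan ℝ (F : Set (Pt d)) := convexHull_subset_affineSpan _ hx
    have hv : x - x₀ ∈ V := by
      rw [← vsub_eq_sub]
      change _ ∈ vectorSpan ℝ _
      rw [← direction_affineSpan]
      exact AffineSubspace.vsub_mem_direction hx' (subset_affineSpan ℝ _ hx₀)
    refine ⟨⟨x - x₀, hv⟩, ?_, by simp⟩
    rw [mem_closedBall_zero_iff]
    change ‖x - x₀‖ ≤ _
    rw [← dist_eq_norm]
    exact Metric.dist_le_diam_of_mem (isCompact_body F).isBounded hx
      (subset_convexHull ℝ _ hx₀)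
  refine ((measure_mono hsub).trans_lt ?_).ne
  rw [hiso.euclideanHausdorffMeasure_image, ← hrank]
  exact (isCompact_closedBall _ _).measure_lt_top

end Simplex

/-! ### Projection onto the polynomials of a facet -/

section Projection

variable {d k : ℕ} {F : Finset (Pt d)}

theorem facePoly_le_contOn : facePoly k F ≤ contOn (body F) := by
  rintro _ ⟨f, hf, rfl⟩
  exact (continuous_of_mem_polyFun hf).continuousOn.congr fun x hx => Set.indicator_of_mem hx f

theorem polyFun_le_contOn (S : Set (Pt d)) : polyFun d k ≤ contOn S :=
  fun _ hf => (continuous_of_mem_polyFun hf).continuousOn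

instance finiteDimensional_facePoly : FiniteDimensional ℝ (facePoly k F) := by
  unfold facePoly
  infer_instance

/-- The facet projections of polynomials can be chosen linearly. -/
theorem exists_linear_faceProj (hF : μHE[d - 1] (body F) ≠ ⊤) (j : ℕ) :
    ∃ P : polyFun d j →ₗ[ℝ] facePoly k F, ∀ g, IsFaceProj k F g.1 (P g).1 := by
  let B := l2Form _ _ (isCompact_body F) hF
  let i := Submodule.inclusion (facePoly_le_contOn (k := k) (F := F))
  let i' := Submodule.inclusion (polyFun_le_contOn (k := j) (body F))
  obtain ⟨P, hP⟩ := exists_linearMap_represent_of_semidefinite (B.compl₁₂ i i) (B.compl₁₂ i' i)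
    (fun y => l2Form_self_nonneg (isCompact_body F) hF _) (fun w y hy => by
      have h0 : B (i y) (i y) = 0 := LinearMap.congr_fun hy y
      have := l2Form_eq_zero_of_self _ _ _ h0
      change B _ _ = 0
      rw [l2Form_comm]
      exact LinearMap.congr_fun this _)
  exact ⟨P, fun g => ⟨(P g).2, fun μ hμ => LinearMap.congr_fun (hP g) ⟨μ, hμ⟩⟩⟩

/-- The facet projection is unique up to null sets for the surface measure. -/
theorem IsFaceProj.ae_eq (hF : μHE[d - 1] (body F) ≠ ⊤) {g m m' : Pt d → ℝ}
    (hm : IsFaceProj k F g m) (hm' : IsFaceProj k F g m') :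
    m =ᵐ[μHE[d - 1].restrict (body F)] m' := by
  let f : facePoly k F := ⟨m, hm.1⟩
  let f' : facePoly k F := ⟨m', hm'.1⟩
  let B := l2Form _ _ (isCompact_body F) hF
  let i := Submodule.inclusion (facePoly_le_contOn (k := k) (F := F))
  have h : B (i (f - f')) (i (f - f')) = 0 := by
    have h1 : B (i f) (i (f - f')) = ∫ x in body F, g x * (f - f').1 x ∂μHE[d - 1] :=
      hm.2 _ (f - f').2
    have h2 : B (i f') (i (f - f')) = ∫ x in body F, g x * (f - f').1 x ∂μHE[d - 1] :=
      hm'.2 _ (f - f').2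
    rw [map_sub i, map_sub B, LinearMap.sub_apply, ← map_sub i, h1, h2, sub_self]
  filter_upwards [ae_eq_zero_of_l2Form_self _ _ _ h] with x hx
  exact sub_eq_zero.1 hx

theorem faceProj_ae_eq (hF : μHE[d - 1] (body F) ≠ ⊤) {g m : Pt d → ℝ}
    (hm : IsFaceProj k F g m) :
    faceProj k F g =ᵐ[μHE[d - 1].restrict (body F)] m := by
  have h : ∃ m, IsFaceProj k F g m := ⟨m, hm⟩
  rw [faceProj, dif_pos h]
  exact h.choose_spec.ae_eq hF hm

end Projection

/-! ### The domain -/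

/-- A Lipschitz boundary is locally contained in the graph of a function along a direction `ν`,
and the translates of such a graph along `ν` are disjoint. -/
theorem volume_frontier_eq_zero {d : ℕ} {Ω : Set (Pt d)} (h : HasLipschitzBoundary Ω) :
    volume (frontier Ω) = 0 := by
  refine measure_null_of_locally_null _ fun x hx => ?_
  obtain ⟨ν, r, L, g, hν, hr, hg, hgν, hΩ⟩ := h x hx
  refine ⟨frontier Ω ∩ Metric.ball x r, inter_mem_nhdsWithin _ (Metric.ball_mem_nhds x hr), ?_⟩
  have hcont : Continuous fun y => inner ℝ ν y - g y :=
    (continuous_const.inner continuous_id).sub hg.continuous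
  -- Off the graph, a point of the ball is interior to `Ω` or to its complement.
  have hsub : frontier Ω ∩ Metric.ball x r ⊆ {y | inner ℝ ν y - g y = 0} := by
    rintro y ⟨hy, hyb⟩
    have hball : Metric.ball x r ∈ nhds y := Metric.isOpen_ball.mem_nhds hyb
    rcases lt_trichotomy (inner ℝ ν y - g y) 0 with hlt | heq | hgt
    · refine absurd (frontier_subset_closure hy) ?_
      rw [mem_closure_iff_frequently, Filter.not_frequently]
      filter_upwards [hball, hcont.continuousAt.eventually_lt_const hlt] with z hz hz0 hzΩ
      have := (hΩ z hz).1 hzΩ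
      linarith
    · exact heq
    · refine absurd ?_ hy.2
      rw [mem_interior_iff_mem_nhds]
      filter_upwards [hball, hcont.continuousAt.eventually_const_lt hgt] with z hz hz0
      exact (hΩ z hz).2 (by linarith)
  refine measure_mono_null hsub ?_
  refine Measure.addHaar_eq_zero_of_disjoint_translates volume
    (fun n : ℕ => ((n : ℝ) + 1)⁻¹ • ν) ?_ ?_ (isClosed_singleton.preimage hcont).measurableSet
  · refine (Metric.isBounded_closedBall (x := (0 : Pt d)) (r := 1)).subset ?_
    rintro _ ⟨n, rfl⟩
    rw [mem_closedBall_zero_iff, norm_smul, hν, mul_one, norm_inv, Real.norm_eq_abs,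
      abs_of_pos (by positivity)]
    exact inv_le_one_of_one_le₀ (by linarith [n.cast_nonneg (α := ℝ)])
  · intro m n hmn
    rw [Function.onFun, Set.disjoint_left]
    rintro y hm hn
    simp only [Set.singleton_add, Set.image_add_left, Set.mem_preimage, Set.mem_ofPred_eq] at hm hn
    -- `g` is constant along `ν`, so `⟪ν, y⟫ - g y` determines the translate containing `y`.
    have key : ∀ t : ℝ, inner ℝ ν (-(t • ν) + y) - g (-(t • ν) + y)
        = inner ℝ ν y - g y - t := fun t => by
      have : -(t • ν) + y = y + (-t) • ν := by rw [neg_smul]; abel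
      rw [this, hgν, inner_add_right, inner_smul_right, real_inner_self_eq_norm_sq, hν]
      ring
    erw [key] at hm hn
    have : ((m : ℝ) + 1)⁻¹ = ((n : ℝ) + 1)⁻¹ := by linarith
    exact hmn (by exact_mod_cast add_right_cancel (inv_injective this))

/-- A function that is square integrable on `Ω` is so on compact subsets of the closure. -/
theorem memLp_restrict_of_subset_closure {d : ℕ} {Ω S : Set (Pt d)} (hΩo : IsOpen Ω)
    (h : HasLipschitzBoundary Ω) (hS : S ⊆ closure Ω) {f : Pt d → ℝ}
    (hf : MemLp f 2 (volume.restrict Ω)) : MemLp f 2 (volume.restrict S) := by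
  have : volume.restrict (closure Ω) = volume.restrict Ω := by
    refine Measure.restrict_congr_set ?_
    refine (ae_eq_set.2 ⟨?_, ?_⟩)
    · rw [← hΩo.frontier_eq]; exact volume_frontier_eq_zero h
    · rw [Set.sdiff_eq_empty.2 subset_closure, measure_empty]
  exact (this ▸ hf).mono_measure (Measure.restrict_mono hS le_rfl)

/-! ### The forms of the scheme -/

namespace Triangulation

variable {d : ℕ} {Ω : Set (Pt d)} (𝒯 : Triangulation Ω)

theorem card_of_mem_cells (K : 𝒯.cells) : K.1.card = d + 1 :=
  (Finset.mem_filter.1 K.2).2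

theorem affineIndependent_of_mem_cells (K : 𝒯.cells) : AffineIndependent ℝ ((↑) : K.1 → Pt d) :=
  𝒯.complex.indep (𝒯.finite.mem_toFinset.1 (Finset.mem_filter.1 K.2).1)

theorem body_subset_closure (K : 𝒯.cells) : body K.1 ⊆ closure Ω :=
  𝒯.space_eq ▸ 𝒯.complex.convexHull_subset_space
    (𝒯.finite.mem_toFinset.1 (Finset.mem_filter.1 K.2).1)

theorem euclideanHausdorffMeasure_facet_ne_top (hd : 0 < d) (F : 𝒯.facets) :
    μHE[d - 1] (body F.1) ≠ ⊤ :=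
  euclideanHausdorffMeasure_body_ne_top hd (Finset.mem_filter.1 F.2).2
    (𝒯.complex.indep (𝒯.finite.mem_toFinset.1 (Finset.mem_filter.1 F.2).1))

end Triangulation

noncomputable section

variable {d k : ℕ} {Ω : Set (Pt d)} {𝒯 : Triangulation Ω}

/-- The restriction of a discrete function to an element, as a polynomial function. -/
def polyOn (K : 𝒯.cells) : Wh 𝒯 k →ₗ[ℝ] polyFun d (k + 1) where
  toFun w := ⟨w.1 K, w.2 K trivial⟩
  map_add' _ _ := rfl
  map_smul' _ _ := rfl

/-- The restriction of a skeleton function to a facet. -/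
def facePolyOn (F : 𝒯.facets) : Mh 𝒯 k →ₗ[ℝ] facePoly k F.1 where
  toFun μ := ⟨μ.1 F, μ.2 F trivial⟩
  map_add' _ _ := rfl
  map_smul' _ _ := rfl

/-- The restriction of a discrete vector field to an element. -/
def vecPolyOn (K : 𝒯.cells) : Vh 𝒯 k →ₗ[ℝ] vecPolyFun d k where
  toFun v := ⟨v.1 K, v.2 K trivial⟩
  map_add' _ _ := rfl
  map_smul' _ _ := rfl

instance finiteDimensional_Wh : FiniteDimensional ℝ (Wh 𝒯 k) :=
  FiniteDimensional.of_injective (LinearMap.pi fun K : 𝒯.cells => polyOn (k := k) K)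
    fun _ _ h => Subtype.ext <| funext fun K => congrArg Subtype.val (congrFun h K)

instance finiteDimensional_Mh : FiniteDimensional ℝ (Mh 𝒯 k) :=
  FiniteDimensional.of_injective (LinearMap.pi fun F : 𝒯.facets => facePolyOn (k := k) F)
    fun _ _ h => Subtype.ext <| funext fun F => congrArg Subtype.val (congrFun h F)

/-- A component of a polynomial vector field. -/
def component (i : Fin d) : vecPolyFun d k →ₗ[ℝ] polyFun d k where
  toFun v := ⟨fun x => v.1 x i, v.2 i⟩
  map_add' _ _ := rfl
  map_smul' _ _ := rfl

instance finiteDimensional_vecPolyFun : FiniteDimensional ℝ (vecPolyFun d k) :=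
  FiniteDimensional.of_injective (LinearMap.pi fun i : Fin d => component (k := k) i)
    fun _ _ h => Subtype.ext <| funext fun x => PiLp.ext fun i =>
      congrFun (congrArg Subtype.val (congrFun h i)) x

instance finiteDimensional_Vh : FiniteDimensional ℝ (Vh 𝒯 k) :=
  FiniteDimensional.of_injective (LinearMap.pi fun K : 𝒯.cells => vecPolyOn (k := k) K)
    fun _ _ h => Subtype.ext <| funext fun K => congrArg Subtype.val (congrFun h K)

/-- Polynomial functions as continuous functions on a set. -/
def polyToCont (S : Set (Pt d)) : polyFun d k →ₗ[ℝ] contOn S :=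
  Submodule.inclusion (polyFun_le_contOn S)

/-- Polynomials on a facet as continuous functions there. -/
def facePolyToCont (F : Finset (Pt d)) : facePoly k F →ₗ[ℝ] contOn (body F) :=
  Submodule.inclusion facePoly_le_contOn

/-- The divergence of polynomial vector fields. -/
def divgCont (S : Set (Pt d)) : vecPolyFun d k →ₗ[ℝ] contOn S where
  toFun v := ⟨divg v.1, by
    have := (contDiff_of_mem_vecPolyFun v.2).continuous_fderiv one_ne_zero
    refine Continuous.continuousOn (continuous_finsetSum _ fun i _ => ?_)
    exact (EuclideanSpace.proj (𝕜 := ℝ) i).continuous.comp (this.clm_apply continuous_const)⟩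
  map_add' v w := by
    ext x
    have hv := (contDiff_of_mem_vecPolyFun v.2).differentiable one_ne_zero
    have hw := (contDiff_of_mem_vecPolyFun w.2).differentiable one_ne_zero
    simp [divg, fderiv_add (hv x) (hw x), Finset.sum_add_distrib]
  map_smul' c v := by
    ext x
    have hv := (contDiff_of_mem_vecPolyFun v.2).differentiable one_ne_zero
    simp [divg, fderiv_const_smul (hv x), Finset.mul_sum]

/-- The component of polynomial vector fields in the direction `n`. -/
def normalCont (S : Set (Pt d)) (n : Pt d) : vecPolyFun d k →ₗ[ℝ] contOn S where
  toFun v := ⟨fun x => inner ℝ (v.1 x) n,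
    ((contDiff_of_mem_vecPolyFun v.2).continuous.inner continuous_const).continuousOn⟩
  map_add' v w := by
    ext x
    simp [inner_add_left]
  map_smul' c v := by
    ext x
    simp [inner_smul_left]

/-- The `L²` form of an element. -/
def cellForm (K : Finset (Pt d)) : contOn (body K) →ₗ[ℝ] contOn (body K) →ₗ[ℝ] ℝ :=
  l2Form volume (body K) (isCompact_body K) (isCompact_body K).measure_lt_top.ne

/-- The `L²` form of a facet, for the surface measure. -/
def facetForm (hd : 0 < d) (F : 𝒯.facets) :
    contOn (body F.1) →ₗ[ℝ] contOn (body F.1) →ₗ[ℝ] ℝ :=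
  l2Form μHE[d - 1] (body F.1) (isCompact_body F.1)
    (𝒯.euclideanHausdorffMeasure_facet_ne_top hd F)

theorem cellForm_self_nonneg (K : Finset (Pt d)) (f : contOn (body K)) : 0 ≤ cellForm K f f :=
  l2Form_self_nonneg _ _ f

theorem facetForm_self_nonneg (hd : 0 < d) (F : 𝒯.facets) (f : contOn (body F.1)) :
    0 ≤ facetForm hd F f f :=
  l2Form_self_nonneg _ _ f

/-- The mass form `(q, r)` of vector fields. -/
def massV (𝒯 : Triangulation Ω) (k : ℕ) : Vh 𝒯 k →ₗ[ℝ] Vh 𝒯 k →ₗ[ℝ] ℝ :=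
  ∑ K : 𝒯.cells, ∑ i : Fin d,
    (cellForm K.1).compl₁₂ (polyToCont _ ∘ₗ component i ∘ₗ vecPolyOn K)
      (polyToCont _ ∘ₗ component i ∘ₗ vecPolyOn K)

/-- The mass form `(u, w)` of scalar functions. -/
def massW (𝒯 : Triangulation Ω) (k : ℕ) : Wh 𝒯 k →ₗ[ℝ] Wh 𝒯 k →ₗ[ℝ] ℝ :=
  ∑ K : 𝒯.cells, (cellForm K.1).compl₁₂ (polyToCont _ ∘ₗ polyOn K) (polyToCont _ ∘ₗ polyOn K)

/-- The pairing `(∇ · r, w)`. -/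
def divForm (𝒯 : Triangulation Ω) (k : ℕ) : Vh 𝒯 k →ₗ[ℝ] Wh 𝒯 k →ₗ[ℝ] ℝ :=
  ∑ K : 𝒯.cells, (cellForm K.1).compl₁₂ (divgCont _ ∘ₗ vecPolyOn K) (polyToCont _ ∘ₗ polyOn K)

open scoped Classical in
/-- The pairing `⟨r · n, μ⟩` on the boundaries of the elements. -/
def traceForm (𝒯 : Triangulation Ω) (k : ℕ) (hd : 0 < d) : Vh 𝒯 k →ₗ[ℝ] Mh 𝒯 k →ₗ[ℝ] ℝ :=
  ∑ K : 𝒯.cells, ∑ F : 𝒯.facets with F.1 ⊆ K.1,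
    (facetForm hd F).compl₁₂ (normalCont _ (normal K.1 F.1) ∘ₗ vecPolyOn K)
      (facePolyToCont _ ∘ₗ facePolyOn F)

/-- A linear version of the facet projection, equal to it almost everywhere on the facet. -/
def linearFaceProj (k j : ℕ) (hd : 0 < d) (F : 𝒯.facets) : polyFun d j →ₗ[ℝ] facePoly k F.1 :=
  (exists_linear_faceProj (k := k) (𝒯.euclideanHausdorffMeasure_facet_ne_top hd F) j).choose

theorem faceProj_ae_eq_linearFaceProj {j : ℕ} (hd : 0 < d) (F : 𝒯.facets) (g : polyFun d j) :
    faceProj k F.1 g.1 =ᵐ[μHE[d - 1].restrict (body F.1)] (linearFaceProj k j hd F g).1 :=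
  faceProj_ae_eq (𝒯.euclideanHausdorffMeasure_facet_ne_top hd F)
    ((exists_linear_faceProj (k := k)
      (𝒯.euclideanHausdorffMeasure_facet_ne_top hd F) j).choose_spec g)

/-- The jump `Π u - û` on a facet `F` of an element `K`. -/
def jump (hd : 0 < d) (K : 𝒯.cells) (F : 𝒯.facets) :
    (Wh 𝒯 k × Mh 𝒯 k) →ₗ[ℝ] contOn (body F.1) :=
  facePolyToCont _ ∘ₗ ((linearFaceProj k (k + 1) hd F ∘ₗ polyOn K ∘ₗ LinearMap.fst ℝ _ _)
    - (facePolyOn F ∘ₗ LinearMap.snd ℝ _ _))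

open scoped Classical in
/-- The stabilization form. -/
def stabForm (𝒯 : Triangulation Ω) (k : ℕ) (hd : 0 < d) :
    (Wh 𝒯 k × Mh 𝒯 k) →ₗ[ℝ] (Wh 𝒯 k × Mh 𝒯 k) →ₗ[ℝ] ℝ :=
  ∑ K : 𝒯.cells, ∑ F : 𝒯.facets with F.1 ⊆ K.1,
    (hK K.1)⁻¹ • (facetForm hd F).compl₁₂ (jump hd K F) (jump hd K F)

theorem massW_apply (u w : Wh 𝒯 k) :
    massW 𝒯 k u w = cellSum 𝒯 fun K x => u.1 K x * w.1 K x := by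
  simp only [massW, LinearMap.sum_apply]
  rfl

theorem massV_apply (q r : Vh 𝒯 k) :
    massV 𝒯 k q r = cellSum 𝒯 fun K x => inner ℝ (q.1 K x) (r.1 K x) := by
  simp only [massV, LinearMap.sum_apply, cellSum, PiLp.inner_apply]
  refine Finset.sum_congr rfl fun K _ => ?_
  rw [integral_finsetSum]
  · refine Finset.sum_congr rfl fun i _ => integral_congr_ae (.of_forall fun x => ?_)
    exact mul_comm _ _
  · intro i _
    refine integrableOn_of_continuousOn (isCompact_body _)
      (isCompact_body _).measure_lt_top.ne (Continuous.continuousOn ?_)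
    exact (continuous_of_mem_polyFun (q.2 K trivial i)).inner
      (continuous_of_mem_polyFun (r.2 K trivial i))

theorem divForm_apply (r : Vh 𝒯 k) (w : Wh 𝒯 k) :
    divForm 𝒯 k r w = cellSum 𝒯 fun K x => divg (r.1 K) x * w.1 K x := by
  simp only [divForm, LinearMap.sum_apply]
  rfl

theorem traceForm_apply (hd : 0 < d) (r : Vh 𝒯 k) (μ : Mh 𝒯 k) :
    traceForm 𝒯 k hd r μ
      = bdrySum 𝒯 fun K F x => inner ℝ (r.1 K x) (normal K.1 F.1) * μ.1 F x := by
  simp only [traceForm, LinearMap.sum_apply]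
  rfl

theorem stabForm_apply (hd : 0 < d) (u w : Wh 𝒯 k) (u' μ : Mh 𝒯 k) :
    stabForm 𝒯 k hd (u, u') (w, μ)
      = bdrySum 𝒯 fun K F x => (hK K.1)⁻¹ * (faceProj k F.1 (u.1 K) x - u'.1 F x)
        * (faceProj k F.1 (w.1 K) x - μ.1 F x) := by
  simp only [stabForm, LinearMap.sum_apply, bdrySum]
  refine Finset.sum_congr rfl fun K _ => Finset.sum_congr rfl fun F _ => ?_
  rw [LinearMap.smul_apply, LinearMap.smul_apply, smul_eq_mul, LinearMap.compl₁₂_apply,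
    facetForm, l2Form_apply, ← integral_const_mul]
  refine integral_congr_ae ?_
  filter_upwards [faceProj_ae_eq_linearFaceProj (k := k) hd F (polyOn K u),
    faceProj_ae_eq_linearFaceProj (k := k) hd F (polyOn K w)] with x hx hx'
  change faceProj k F.1 (u.1 K) x = _ at hx
  change faceProj k F.1 (w.1 K) x = _ at hx'
  rw [hx, hx', mul_assoc]
  rfl

theorem formA_eq_mixedForm (hd : 0 < d) (q : Vh 𝒯 k) (u : Wh 𝒯 k) (uhat : Mh 𝒯 k)
    (r : Vh 𝒯 k) (w : Wh 𝒯 k) (μ : Mh 𝒯 k) :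
    formA 𝒯 k q u uhat r w μ = mixedForm (massV 𝒯 k) (divForm 𝒯 k) (traceForm 𝒯 k hd)
      (stabForm 𝒯 k hd) q u uhat r w μ := by
  simp only [formA, mixedForm, massV_apply, divForm_apply, traceForm_apply, stabForm_apply,
    mul_comm]

theorem massW_self_nonneg (w : Wh 𝒯 k) : 0 ≤ massW 𝒯 k w w := by
  simp only [massW, LinearMap.sum_apply, LinearMap.compl₁₂_apply]
  exact Finset.sum_nonneg fun K _ => cellForm_self_nonneg K.1 _

theorem massW_comm (u w : Wh 𝒯 k) : massW 𝒯 k u w = massW 𝒯 k w u := by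
  simp only [massW_apply, mul_comm]

/-- A polynomial that vanishes almost everywhere on an element is zero. -/
theorem poly_eq_zero_of_cellForm {j : ℕ} (K : 𝒯.cells) (f : polyFun d j)
    (h : cellForm K.1 (polyToCont _ f) (polyToCont _ f) = 0) : f = 0 :=
  Subtype.ext <| eq_zero_of_integral_mul_self_eq_zero (isCompact_body _)
    (interior_body_nonempty (𝒯.card_of_mem_cells K) (𝒯.affineIndependent_of_mem_cells K)) f.2 h

theorem massW_definite (w : Wh 𝒯 k) (h : massW 𝒯 k w w = 0) : w = 0 := by
  simp only [massW, LinearMap.sum_apply, LinearMap.compl₁₂_apply] at h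
  rw [Finset.sum_eq_zero_iff_of_nonneg fun K _ => cellForm_self_nonneg K.1 _] at h
  refine Subtype.ext <| funext fun K => ?_
  exact congrArg Subtype.val (poly_eq_zero_of_cellForm K (polyOn K w) (h K (Finset.mem_univ K)))

theorem massV_self_nonneg (q : Vh 𝒯 k) : 0 ≤ massV 𝒯 k q q := by
  simp only [massV, LinearMap.sum_apply, LinearMap.compl₁₂_apply]
  exact Finset.sum_nonneg fun K _ => Finset.sum_nonneg fun i _ => cellForm_self_nonneg K.1 _

theorem massV_comm (q r : Vh 𝒯 k) : massV 𝒯 k q r = massV 𝒯 k r q := by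
  simp only [massV_apply, real_inner_comm]

theorem massV_definite (q : Vh 𝒯 k) (h : massV 𝒯 k q q = 0) : q = 0 := by
  simp only [massV, LinearMap.sum_apply, LinearMap.compl₁₂_apply] at h
  rw [Finset.sum_eq_zero_iff_of_nonneg fun K _ =>
    Finset.sum_nonneg fun i _ => cellForm_self_nonneg K.1 _] at h
  refine Subtype.ext <| funext fun K => funext fun x => PiLp.ext fun i => ?_
  have hK := h K (Finset.mem_univ K)
  rw [Finset.sum_eq_zero_iff_of_nonneg fun i _ => cellForm_self_nonneg K.1 _] at hK
  exact congrFun (congrArg Subtype.val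
    (poly_eq_zero_of_cellForm K (component i (vecPolyOn K q)) (hK i (Finset.mem_univ i)))) x

theorem stabForm_self_nonneg (hd : 0 < d) (x : Wh 𝒯 k × Mh 𝒯 k) :
    0 ≤ stabForm 𝒯 k hd x x := by
  simp only [stabForm, LinearMap.sum_apply]
  exact Finset.sum_nonneg fun K _ => Finset.sum_nonneg fun F _ =>
    mul_nonneg (inv_nonneg.2 Metric.diam_nonneg) (facetForm_self_nonneg hd F _)

theorem stabForm_comm (hd : 0 < d) (x y : Wh 𝒯 k × Mh 𝒯 k) :
    stabForm 𝒯 k hd x y = stabForm 𝒯 k hd y x := by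
  simp only [stabForm, LinearMap.sum_apply, LinearMap.smul_apply, LinearMap.compl₁₂_apply]
  refine Finset.sum_congr rfl fun K _ => Finset.sum_congr rfl fun F _ => ?_
  rw [facetForm, l2Form_comm]

/-- A skeleton function without stabilization energy vanishes almost everywhere on the facets of
the elements, so it is invisible to the stabilization and to the trace pairing. -/
theorem stabForm_skeleton (hd : 0 < d) (μ : Mh 𝒯 k)
    (h : stabForm 𝒯 k hd (0, μ) (0, μ) = 0) :
    stabForm 𝒯 k hd (0, μ) = 0 ∧ ∀ r, traceForm 𝒯 k hd r μ = 0 := by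
  classical
  simp only [stabForm, LinearMap.sum_apply] at h
  have hnn : ∀ (K : 𝒯.cells) (F : 𝒯.facets), 0 ≤
      ((hK K.1)⁻¹ • (facetForm hd F).compl₁₂ (jump hd K F) (jump hd K F)) (0, μ) (0, μ) :=
    fun K F => mul_nonneg (inv_nonneg.2 Metric.diam_nonneg) (facetForm_self_nonneg hd F _)
  rw [Finset.sum_eq_zero_iff_of_nonneg fun K _ => Finset.sum_nonneg fun F _ => hnn K F] at h
  have hz : ∀ (K : 𝒯.cells) (F : 𝒯.facets), F.1 ⊆ K.1 →
      facetForm hd F (jump hd K F (0, μ)) = 0 := by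
    intro K F hFK
    have h1 := h K (Finset.mem_univ K)
    rw [Finset.sum_eq_zero_iff_of_nonneg fun F _ => hnn K F] at h1
    have h2 := h1 F (by simpa using hFK)
    rw [LinearMap.smul_apply, LinearMap.smul_apply, smul_eq_mul] at h2
    exact l2Form_eq_zero_of_self _ _ _ ((mul_eq_zero.1 h2).resolve_left
      (inv_ne_zero (hK_pos hd (𝒯.card_of_mem_cells K)).ne'))
  constructor
  · refine LinearMap.ext fun y => ?_
    simp only [stabForm, LinearMap.sum_apply, LinearMap.zero_apply]
    refine Finset.sum_eq_zero fun K _ => Finset.sum_eq_zero fun F hF => ?_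
    rw [LinearMap.smul_apply, LinearMap.smul_apply, LinearMap.compl₁₂_apply,
      hz K F (Finset.mem_filter.1 hF).2]
    simp
  · intro r
    simp only [traceForm, LinearMap.sum_apply]
    refine Finset.sum_eq_zero fun K _ => Finset.sum_eq_zero fun F hF => ?_
    have hj : jump hd K F (0, μ) = -facePolyToCont _ (facePolyOn F μ) := by
      simp [jump]
    have := hz K F (Finset.mem_filter.1 hF).2
    rw [hj, map_neg, neg_eq_zero] at this
    rw [LinearMap.compl₁₂_apply, facetForm, l2Form_comm]
    exact LinearMap.congr_fun this _

end

/-! ### The energy -/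

noncomputable section

/-- A primitive of `u ↦ f(u, v)`. -/
def TimeScheme.primitive : TimeScheme → ℝ → ℝ → ℝ
  | fullyImplicit, u, _ => u ^ 4 / 4 - u ^ 2 / 2
  | convexSplitting, u, v => u ^ 4 / 4 - v * u

/-- The second order Taylor coefficient of the primitive in its first argument. -/
def TimeScheme.quadratic : TimeScheme → ℝ → ℝ
  | fullyImplicit, u => 3 / 2 * u ^ 2 - 1 / 2
  | convexSplitting, u => 3 / 2 * u ^ 2

/-- The coefficients of `t ^ 3` and `t ^ 4` are the same for both schemes. -/
theorem TimeScheme.primitive_add (s : TimeScheme) (u v w t : ℝ) :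
    s.primitive (u + t * w) v = s.primitive u v + t * (s.f u v * w)
      + t ^ 2 * (s.quadratic u * w ^ 2) + t ^ 3 * (u * w ^ 3) + t ^ 4 * (w ^ 4 / 4) := by
  cases s <;> simp only [primitive, quadratic, f] <;> ring

theorem TimeScheme.le_primitive (s : TimeScheme) (u v : ℝ) :
    -(1 / 4) - v ^ 2 / 2 ≤ s.primitive u v := by
  cases s <;> simp only [primitive] <;>
    nlinarith [sq_nonneg (u ^ 2 - 1), sq_nonneg (u - v), sq_nonneg v]

theorem TimeScheme.continuous_primitive (s : TimeScheme) :
    Continuous fun p : ℝ × ℝ => s.primitive p.1 p.2 := by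
  cases s <;> simp only [primitive] <;> fun_prop

theorem TimeScheme.continuous_f (s : TimeScheme) :
    Continuous fun p : ℝ × ℝ => s.f p.1 p.2 := by
  cases s <;> simp only [f] <;> fun_prop

theorem TimeScheme.continuous_quadratic (s : TimeScheme) : Continuous s.quadratic := by
  cases s
  · change Continuous fun u : ℝ => 3 / 2 * u ^ 2 - 1 / 2
    fun_prop
  · change Continuous fun u : ℝ => 3 / 2 * u ^ 2
    fun_prop

theorem hasDerivAt_integral_primitive {d : ℕ} {S : Set (Pt d)} (hS : IsCompact S)
    (s : TimeScheme) {u v w : Pt d → ℝ} (hu : Continuous u) (hv : Continuous v)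
    (hw : Continuous w) :
    HasDerivAt (fun t : ℝ => ∫ x in S, s.primitive (u x + t * w x) (v x))
      (∫ x in S, s.f (u x) (v x) * w x) 0 := by
  have hint : ∀ g : Pt d → ℝ, Continuous g → IntegrableOn g S :=
    fun g hg => integrableOn_of_continuousOn hS hS.measure_lt_top.ne hg.continuousOn
  have hp : Continuous fun x => s.primitive (u x) (v x) :=
    s.continuous_primitive.comp (hu.prodMk hv)
  have hf : Continuous fun x => s.f (u x) (v x) := s.continuous_f.comp (hu.prodMk hv)
  have hq : Continuous fun x => s.quadratic (u x) := s.continuous_quadratic.comp hu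
  have hexp : (fun t : ℝ => ∫ x in S, s.primitive (u x + t * w x) (v x)) = fun t : ℝ =>
      (∫ x in S, s.primitive (u x) (v x)) + t * (∫ x in S, s.f (u x) (v x) * w x)
      + t ^ 2 * (∫ x in S, s.quadratic (u x) * w x ^ 2) + t ^ 3 * (∫ x in S, u x * w x ^ 3)
      + t ^ 4 * ∫ x in S, w x ^ 4 / 4 := by
    funext t
    simp only [s.primitive_add, ← integral_const_mul]
    rw [integral_add (hint _ (by fun_prop)) (hint _ (by fun_prop)),
      integral_add (hint _ (by fun_prop)) (hint _ (by fun_prop)),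
      integral_add (hint _ (by fun_prop)) (hint _ (by fun_prop)),
      integral_add (hint _ (by fun_prop)) (hint _ (by fun_prop))]
  rw [hexp]
  have hpow : ∀ (n : ℕ) (c : ℝ), HasDerivAt (fun t : ℝ => t ^ (n + 2) * c) 0 0 := fun n c => by
    simpa using (hasDerivAt_pow (n + 2) (0 : ℝ)).mul_const c
  simpa using (((((hasDerivAt_id (0 : ℝ)).mul_const (∫ x in S, s.f (u x) (v x) * w x)).const_add
    (∫ x in S, s.primitive (u x) (v x))).fun_add
      (hpow 0 _)).fun_add (hpow 1 _)).fun_add (hpow 2 _)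

variable {d k : ℕ} {Ω : Set (Pt d)} {𝒯 : Triangulation Ω}

theorem continuous_of_mem_Wh (w : Wh 𝒯 k) (K : 𝒯.cells) : Continuous (w.1 K) :=
  continuous_of_mem_polyFun (w.2 K trivial)

theorem integrableOn_body {K : Finset (Pt d)} {g : Pt d → ℝ} (hg : Continuous g) :
    IntegrableOn g (body K) :=
  integrableOn_of_continuousOn (isCompact_body K) (isCompact_body K).measure_lt_top.ne
    hg.continuousOn

/-- The nonlinear part of the energy of the scheme. -/
def potential (s : TimeScheme) (ε : ℝ) (v u : Wh 𝒯 k) : ℝ :=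
  cellSum 𝒯 fun K x => ε⁻¹ * s.primitive (u.1 K x) (v.1 K x)

/-- The derivative of the nonlinear part of the energy. -/
def reaction (s : TimeScheme) (ε : ℝ) (v u : Wh 𝒯 k) : Wh 𝒯 k →ₗ[ℝ] ℝ where
  toFun w := cellSum 𝒯 fun K x => ε⁻¹ * s.f (u.1 K x) (v.1 K x) * w.1 K x
  map_add' w w' := by
    have hc : ∀ (K : 𝒯.cells) (z : Wh 𝒯 k), IntegrableOn
        (fun x => ε⁻¹ * s.f (u.1 K x) (v.1 K x) * z.1 K x) (body K.1) := fun K z =>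
      integrableOn_body ((continuous_const.mul (s.continuous_f.comp
        ((continuous_of_mem_Wh u K).prodMk (continuous_of_mem_Wh v K)))).mul
        (continuous_of_mem_Wh z K))
    simp only [cellSum, ← Finset.sum_add_distrib]
    refine Finset.sum_congr rfl fun K _ => ?_
    rw [← integral_add (hc K w) (hc K w')]
    simp [mul_add]
  map_smul' c w := by
    simp only [cellSum, RingHom.id_apply, smul_eq_mul, Finset.mul_sum, ← integral_const_mul]
    refine Finset.sum_congr rfl fun K _ => ?_
    simp [mul_left_comm]

theorem continuous_potential (s : TimeScheme) (ε : ℝ) (v : Wh 𝒯 k) :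
    Continuous (potential s ε v) := by
  -- Coordinates give `Wh` the local compactness needed to integrate a continuous family.
  let e := (Module.finBasis ℝ (Wh 𝒯 k)).equivFunL
  rw [← e.symm.toHomeomorph.comp_continuous_iff']
  refine continuous_finsetSum _ fun K _ => ?_
  refine continuous_parametric_integral_of_continuous ?_ (isCompact_body K.1)
  let E : (Fin (Module.finrank ℝ (Wh 𝒯 k)) → ℝ) →ₗ[ℝ] C(Pt d, ℝ) :=
    { toFun := fun c => ⟨(e.symm c).1 K, continuous_of_mem_Wh _ K⟩
      map_add' := fun c c' => by ext x; simp
      map_smul' := fun r c => by ext x; simp }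
  have hE : Continuous E := E.continuous_of_finiteDimensional
  have hjoint : Continuous fun p : (Fin (Module.finrank ℝ (Wh 𝒯 k)) → ℝ) × Pt d =>
      E p.1 p.2 := by fun_prop
  exact continuous_const.mul (s.continuous_primitive.comp
    (hjoint.prodMk ((continuous_of_mem_Wh v K).comp continuous_snd)))

theorem exists_le_potential (s : TimeScheme) {ε : ℝ} (hε : 0 < ε) (v : Wh 𝒯 k) :
    ∃ c, ∀ u, c ≤ potential s ε v u := by
  refine ⟨cellSum 𝒯 fun K x => ε⁻¹ * (-(1 / 4) - v.1 K x ^ 2 / 2), fun u => ?_⟩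
  refine Finset.sum_le_sum fun K _ => ?_
  have hv := continuous_of_mem_Wh v K
  refine integral_mono (integrableOn_body (by fun_prop)) (integrableOn_body ?_) fun x => ?_
  · exact continuous_const.mul (s.continuous_primitive.comp
      ((continuous_of_mem_Wh u K).prodMk hv))
  · exact mul_le_mul_of_nonneg_left (s.le_primitive _ _) (inv_nonneg.2 hε.le)

theorem hasDerivAt_potential (s : TimeScheme) (ε : ℝ) (v u w : Wh 𝒯 k) :
    HasDerivAt (fun t : ℝ => potential s ε v (u + t • w)) (reaction s ε v u w) 0 := by
  refine HasDerivAt.fun_sum fun K _ => ?_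
  have h := (hasDerivAt_integral_primitive (isCompact_body K.1) s (continuous_of_mem_Wh u K)
    (continuous_of_mem_Wh v K) (continuous_of_mem_Wh w K)).const_mul ε⁻¹
  simp only [← integral_const_mul, ← mul_assoc] at h
  exact h

/-! ### Solvability -/

/-- Every time step is solvable: the step is an implicit gradient step for the energy, in the
metric given by the condensed form. -/
theorem exists_isStep (hd : 0 < d) (s : TimeScheme) {ε τ : ℝ} (hε : 0 < ε) (hτ : 0 < τ)
    (v : Wh 𝒯 k) :
    ∃ (p : Vh 𝒯 k) (φ : Wh 𝒯 k) (φhat : Mh 𝒯 k) (q : Vh 𝒯 k) (u : Wh 𝒯 k) (uhat : Mh 𝒯 k),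
      IsStep 𝒯 k s ε τ v p φ φhat q u uhat := by
  obtain ⟨Q, U, a, ha_symm, ha_nonneg, ha⟩ := exists_static_condensation (massV 𝒯 k)
    (divForm 𝒯 k) (traceForm 𝒯 k hd) (stabForm 𝒯 k hd) massV_self_nonneg massV_definite
    massV_comm (stabForm_self_nonneg hd) (stabForm_comm hd) (stabForm_skeleton hd)
  let G : Wh 𝒯 k → ℝ := fun u => potential s ε v u + ε / 2 * a u u
  let g : Wh 𝒯 k → Wh 𝒯 k →ₗ[ℝ] ℝ := fun u => reaction s ε v u + ε • a u
  obtain ⟨c, hc⟩ := exists_le_potential s hε v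
  have hcont : Continuous fun u : Wh 𝒯 k => a u u := by
    obtain ⟨n, S, hS⟩ := exists_linearMap_inner_eq a ha_symm ha_nonneg
    have : Continuous S := S.continuous_of_finiteDimensional
    simp only [hS]
    fun_prop
  have hG : Continuous G := (continuous_potential s ε v).add (continuous_const.mul hcont)
  have hlow : ∀ u, c ≤ G u := fun u =>
    le_add_of_le_of_nonneg (hc u) (mul_nonneg (by positivity) (ha_nonneg u))
  have hderiv : ∀ u w, HasDerivAt (fun t : ℝ => G (u + t • w)) (g u w) 0 := by
    intro u w
    refine (hasDerivAt_potential s ε v u w).add ?_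
    have hexp : (fun t : ℝ => ε / 2 * a (u + t • w) (u + t • w))
        = fun t : ℝ => ε / 2 * a u u + t * (ε * a u w) + t ^ 2 * (ε / 2 * a w w) := by
      funext t
      simp only [map_add, map_smul, LinearMap.add_apply, LinearMap.smul_apply, smul_eq_mul,
        ha_symm w u]
      ring
    rw [hexp]
    simpa using (((hasDerivAt_id (0 : ℝ)).mul_const (ε * a u w)).const_add (ε / 2 * a u u)).fun_add
      ((hasDerivAt_pow 2 (0 : ℝ)).mul_const (ε / 2 * a w w))
  obtain ⟨u, φ, hu, hφ⟩ := exists_implicit_gradient_step (massW 𝒯 k) a massW_self_nonneg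
    massW_definite massW_comm ha_symm ha_nonneg G g hG hlow hderiv v hτ
  refine ⟨Q φ, φ, U φ, Q u, u, U u, fun r w μ => ?_, fun r w μ => ?_⟩
  · rw [formA_eq_mixedForm hd, ha]
    have h1 : (cellSum 𝒯 fun K x => (u.1 K x - v.1 K x) / τ * w.1 K x)
        = τ⁻¹ * massW 𝒯 k (u - v) w := by
      simp only [massW_apply, cellSum, Finset.mul_sum, ← integral_const_mul]
      refine Finset.sum_congr rfl fun K _ => integral_congr_ae (.of_forall fun x => ?_)
      simp [div_eq_inv_mul, mul_assoc]
    rw [h1, eq_neg_of_add_eq_zero_left (hu w)]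
    field_simp
    ring
  · rw [formA_eq_mixedForm hd, ha, ← massW_apply, hφ w]
    exact sub_self _

/-- The `L²` projection onto the discrete space. Square integrability on the closed elements
needs that the boundary of the domain is a null set. -/
theorem exists_l2_projection (hΩo : IsOpen Ω) (hΩL : HasLipschitzBoundary Ω) {u₀ : Pt d → ℝ}
    (hu₀ : MemLp u₀ 2 (volume.restrict Ω)) :
    ∃ u : Wh 𝒯 k, ∀ w : Wh 𝒯 k, cellSum 𝒯 (fun K x => u.1 K x * w.1 K x)
      = cellSum 𝒯 (fun K x => u₀ x * w.1 K x) := by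
  have hint : ∀ (K : 𝒯.cells) (w : Wh 𝒯 k),
      IntegrableOn (fun x => u₀ x * w.1 K x) (body K.1) := by
    intro K w
    have h0 := memLp_restrict_of_subset_closure hΩo hΩL (𝒯.body_subset_closure K) hu₀
    have hw := continuous_of_mem_Wh w K
    have h1 : MemLp (w.1 K) 2 (volume.restrict (body K.1)) :=
      (memLp_two_iff_integrable_sq hw.aestronglyMeasurable).2 (integrableOn_body (hw.pow 2))
    exact h0.integrable_mul h1
  let l : Wh 𝒯 k →ₗ[ℝ] ℝ :=
    { toFun := fun w => cellSum 𝒯 (fun K x => u₀ x * w.1 K x)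
      map_add' := fun w w' => by
        simp only [cellSum, ← Finset.sum_add_distrib]
        refine Finset.sum_congr rfl fun K _ => ?_
        rw [← integral_add (hint K w) (hint K w')]
        simp [mul_add]
      map_smul' := fun c w => by
        simp only [cellSum, RingHom.id_apply, smul_eq_mul, Finset.mul_sum, ← integral_const_mul]
        refine Finset.sum_congr rfl fun K _ => ?_
        simp [mul_left_comm] }
  obtain ⟨P, hP⟩ := exists_linearMap_represent_of_definite (massW 𝒯 k) massW_self_nonneg
    massW_definite (LinearMap.id : (Wh 𝒯 k →ₗ[ℝ] ℝ) →ₗ[ℝ] (Wh 𝒯 k →ₗ[ℝ] ℝ))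
  exact ⟨P l, fun w => (massW_apply _ _).symm.trans (hP l w)⟩

end

end HDG

theorem mainTheorem7 {d : ℕ} (hd : d = 2 ∨ d = 3) {Ω : Set (HDG.Pt d)}
    (hΩo : IsOpen Ω) (hΩc : IsConnected Ω) (hΩL : HDG.HasLipschitzBoundary Ω)
    (𝒯 : HDG.Triangulation Ω) (k : ℕ) (s : HDG.TimeScheme)
    (ε T : ℝ) (hε : 0 < ε) (hT : 0 < T) (N : ℕ) (hN : 0 < N)
    (u₀ : HDG.Pt d → ℝ) (hu₀ : MemLp u₀ 2 (volume.restrict Ω)) :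
    (∃ (p : ℕ → HDG.Vh 𝒯 k) (φ : ℕ → HDG.Wh 𝒯 k) (φhat : ℕ → HDG.Mh 𝒯 k)
        (q : ℕ → HDG.Vh 𝒯 k) (u : ℕ → HDG.Wh 𝒯 k) (uhat : ℕ → HDG.Mh 𝒯 k),
      HDG.IsSolution 𝒯 k s ε (T / N) N u₀ p φ φhat q u uhat) ∧
    (∀ uprev : HDG.Wh 𝒯 k,
      ∃ (p : HDG.Vh 𝒯 k) (φ : HDG.Wh 𝒯 k) (φhat : HDG.Mh 𝒯 k)
        (q : HDG.Vh 𝒯 k) (u : HDG.Wh 𝒯 k) (uhat : HDG.Mh 𝒯 k),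
      HDG.IsStep 𝒯 k s ε (T / N) uprev p φ φhat q u uhat) := by
  have hd0 : 0 < d := by omega
  have hτ : 0 < T / N := div_pos hT (Nat.cast_pos.2 hN)
  have hstep := HDG.exists_isStep (𝒯 := 𝒯) (k := k) hd0 s hε hτ
  refine ⟨?_, hstep⟩
  obtain ⟨u0, hu0⟩ := HDG.exists_l2_projection (𝒯 := 𝒯) (k := k) hΩo hΩL hu₀
  choose p φ φhat q u uhat h using hstep
  let v : ℕ → HDG.Wh 𝒯 k := fun n => Nat.rec u0 (fun _ w => u w) n
  refine ⟨fun n => p (v (n - 1)), fun n => φ (v (n - 1)), fun n => φhat (v (n - 1)),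
    fun n => q (v (n - 1)), v, fun n => uhat (v (n - 1)), fun w => sub_eq_zero.2 (hu0 w),
    fun n hn _ => ?_⟩
  obtain ⟨m, rfl⟩ := Nat.exists_eq_add_of_le' hn
  exact h (v m)
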